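/- Let $T$ be a (finite, simplicial) triangulation of a closed connected surface $M$ with vertex set $V=\{v_1,\dots,v_N\}$. A PL metric on $(M,T)$ is a positive function $d$ on the set of edges such that the three strict triangle inequalities hold in every triangle of $T$; write $d_{ij}=d(v_iv_j)$. Each triangle is then regarded as a Euclidean triangle, and the curvature of $d$ at $v_i$ is $K_i=2\pi-(\text{sum of the inner angles at } v_i \text{ of all triangles of } T \text{ containing } v_i)$. Fix a PL metric $d$. For $u\in\mathbb R^N_{>0}$ let $u*d$ be the edge function $(u*d)_{ij}=u_iu_jd_{ij}$; let $\mathcal U=\{u\in\mathbb R_{>0}^N : u*d \text{ is a PL metric}\}$, and for $u\in\mathcal U$ let $K(u)=(K_1(u),\dots,K_N(u))$ be the curvature of $u*d$. A solution of the combinatorial Yamabe flow on an interval $J\ni 0$ is a map $u:J\to\mathcal U$ with $\frac{du_i}{dt}=-u_iK_i(u)$ and $u_i(0)=1$ for all $i$. Theorem 1.2. (a) For all $u\in\mathcal U$ and all $i,j$ the partial derivatives $\partial K_i/\partial u_j$ exist at $u$, and the matrix $[c_{ij}(u)]_{N\times N}$ with $c_{ij}(u)=-u_j\,\partial K_i/\partial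 u_j$ is symmetric and negative semidefinite. Along every solution $u(t)$ of the combinatorial Yamabe flow on an interval $J$, the curvature $K_i(t)=K_i(u(t))$ satisfies $$\frac{dK_i}{dt}=\sum_{j=1}^N c_{ij}(u(t))\,K_j(t)\qquad(i=1,\dots,N,\ t\in J).$$ In particular, $\sum_{i=1}^N K_i(t)^2$ is nonincreasing in $t$. (b) The combinatorial Yamabe flow is variational: let $w_i=\log u_i$ and let $\mathcal W=\{(\log u_1,\dots,\log u_N) : u\in\mathcal U\}\subset\mathbb R^N$. There is a function $F$ on $\mathcal W$ that is locally convex (every point of $\mathcal W$ has a convex neighbourhood in $\mathcal W$ on which $F$ is convex) and differentiable with $\partial F/\partial w_i=K_i$, such that a map $u:J\to\mathcal U$ solves the combinatorial Yamabe flow if and only if $w(t)=(\log u_1(t),\dots,\log u_N(t))$ solves $\frac{dw}{dt}=-\nabla F(w)$, $w(0)=0$. (c) (Local rigidity) The curvature $K$ maps $\{u\in\mathcal U : \prod_{i=1}^N u_i=1\}$ into $\{k\in\mathbb R^N : \sum_{i=1}^N k_i=2\pi\chi(M)\}$, and as a map between these two spaces it is a local homeomorphism. -/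

import Mathlib

open scoped Gradient Topology

namespace CombYamabe

section Triangulation

variable {V : Type*} [DecidableEq V]

/-- The 1-skeleton of an abstract simplicial complex, as a graph on its vertices. -/
def oneSkeleton (T : AbstractSimplicialComplex V) : SimpleGraph V where
  Adj i j := i ≠ j ∧ {i, j} ∈ T
  symm := ⟨fun i j h => ⟨h.1.symm, by rw [Finset.pair_comm]; exact h.2⟩⟩
  loopless := ⟨fun _ h => h.1 rfl⟩

/-- The link of the vertex `v` in a complex of dimension at most two, as a graph: its vertices are
the `w` for which `vw` is an edge, its edges are the pairs `a, b` for which `vab` is a triangle. -/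
def link (T : AbstractSimplicialComplex V) (v : V) : SimpleGraph {w : V // w ≠ v ∧ {v, w} ∈ T} where
  Adj a b := a ≠ b ∧ {v, a.1, b.1} ∈ T
  symm := ⟨fun a b h => ⟨h.1.symm, by rw [Finset.pair_comm]; exact h.2⟩⟩
  loopless := ⟨fun _ h => h.1 rfl⟩

/-- `T` (a finite complex, when `V` is finite) is a triangulation of a closed connected surface:
it is connected, has dimension at most two, and the link of each vertex is a cycle, i.e. a
connected graph all of whose vertices have exactly two neighbours. -/
structure IsClosedSurface (T : AbstractSimplicialComplex V) : Prop where
  connected : (oneSkeleton T).Connected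
  card_le_three : ∀ s ∈ T, s.card ≤ 3
  link_connected : ∀ v, (link T v).Connected
  link_two_regular : ∀ v w, ((link T v).neighborSet w).ncard = 2

open Classical in
/-- The `k`-simplices of `T`. -/
noncomputable def simplices [Fintype V] (T : AbstractSimplicialComplex V) (k : ℕ) :
    Finset (Finset V) :=
  Finset.univ.filter fun s => s ∈ T ∧ s.card = k + 1

/-- The Euler characteristic of a triangulated surface, (vertices) - (edges) + (triangles). -/
noncomputable def eulerChar [Fintype V] (T : AbstractSimplicialComplex V) : ℤ :=
  (simplices T 0).card - (simplices T 1).card + (simplices T 2).card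

end Triangulation

section Metric

variable {V : Type*} [DecidableEq V]

/-- `d` is a PL (piecewise flat) metric associated to `T`: it assigns to every edge a positive
length, and the three strict triangle inequalities hold in each triangle. In a triangle `t`, the
edge opposite to the vertex `i` is `t.erase i`. The values of `d` on sets that are not edges of
`T` play no role. -/
structure IsPLMetric [Fintype V] (T : AbstractSimplicialComplex V) (d : Finset V → ℝ) : Prop where
  pos : ∀ e ∈ simplices T 1, 0 < d e
  triangle : ∀ t ∈ simplices T 2, ∀ i ∈ t, d (t.erase i) < ∑ j ∈ t.erase i, d (t.erase j)

/-- The conformal change `u * d`: an edge with vertices `v, v'` gets the length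
`u v * u v' * d (v v')`. -/
def conformalChange (u : V → ℝ) (d : Finset V → ℝ) : Finset V → ℝ :=
  fun e => (∏ v ∈ e, u v) * d e

/-- The inner angle at the vertex `i` of the Euclidean triangle `t` with edge lengths `d`, by the
law of cosines: for `t = {i, j, k}` with edge lengths `x` (of `ij`), `y` (of `ik`) and `z`
(of `jk`) it is `arccos ((x ^ 2 + y ^ 2 - z ^ 2) / (2 x y))`. -/
noncomputable def innerAngle (d : Finset V → ℝ) (t : Finset V) (i : V) : ℝ :=
  Real.arccos ((∑ j ∈ t.erase i, d (t.erase j) ^ 2 - d (t.erase i) ^ 2) /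
    (2 * ∏ j ∈ t.erase i, d (t.erase j)))

theorem innerAngle_eq (d : Finset V → ℝ) {i j k : V} (hij : i ≠ j) (hik : i ≠ k) (hjk : j ≠ k) :
    innerAngle d {i, j, k} i =
      Real.arccos ((d {i, j} ^ 2 + d {i, k} ^ 2 - d {j, k} ^ 2) /
        (2 * (d {i, j} * d {i, k}))) := by
  have h1 : ({i, j, k} : Finset V).erase i = {j, k} := by grind
  have h2 : ({i, j, k} : Finset V).erase j = {i, k} := by grind
  have h3 : ({i, j, k} : Finset V).erase k = {i, j} := by grind
  rw [innerAngle, h1, Finset.sum_pair hjk, Finset.prod_pair hjk, h2, h3, add_comm (d {i, k} ^ 2),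
    mul_comm (d {i, k})]

/-- `innerAngle` is the angle of every Euclidean triangle with the given edge lengths. -/
theorem innerAngle_eq_angle (d : Finset V → ℝ) {i j k : V} (hij : i ≠ j) (hik : i ≠ k)
    (hjk : j ≠ k) (p : V → EuclideanSpace ℝ (Fin 2)) (h1 : dist (p i) (p j) = d {i, j})
    (h2 : dist (p i) (p k) = d {i, k}) (h3 : dist (p j) (p k) = d {j, k}) :
    innerAngle d {i, j, k} i = EuclideanGeometry.angle (p j) (p i) (p k) := by
  rw [innerAngle_eq d hij hik hjk, ← h1, ← h2, ← h3, EuclideanGeometry.angle,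
    InnerProductGeometry.angle,
    real_inner_eq_norm_mul_self_add_norm_mul_self_sub_norm_sub_mul_self_div_two,
    vsub_sub_vsub_cancel_right, ← dist_eq_norm_vsub, ← dist_eq_norm_vsub, ← dist_eq_norm_vsub,
    dist_comm (p j) (p i), dist_comm (p k) (p i), div_div]
  congr 2
  ring

/-- The curvature at the vertex `i`: `2 π` minus the sum of the inner angles at `i` of all the
triangles having `i` as a vertex. -/
noncomputable def curvature [Fintype V] (T : AbstractSimplicialComplex V) (d : Finset V → ℝ)
    (i : V) : ℝ :=
  2 * Real.pi - ∑ t ∈ simplices T 2 with i ∈ t, innerAngle d t i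

end Metric

section Conformal

variable {V : Type*} [DecidableEq V] [Fintype V]

/-- The positive functions `u` on the vertices for which `u * d` is again a PL metric. -/
def conformalFactors (T : AbstractSimplicialComplex V) (d : Finset V → ℝ) : Set (V → ℝ) :=
  {u | (∀ i, 0 < u i) ∧ IsPLMetric T (conformalChange u d)}

/-- The conformal factors normalized by `∏ u i = 1`. -/
def normalizedConformalFactors (T : AbstractSimplicialComplex V) (d : Finset V → ℝ) :
    Set (V → ℝ) :=
  {u | u ∈ conformalFactors T d ∧ ∏ i, u i = 1}

/-- The curvature of `u * d`, as a function on the vertices. -/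
noncomputable def curvatureMap (T : AbstractSimplicialComplex V) (d : Finset V → ℝ) (u : V → ℝ) :
    V → ℝ :=
  curvature T (conformalChange u d)

/-- The hyperplane `∑ k i = 2 π χ`. -/
def gaussBonnetPlane (T : AbstractSimplicialComplex V) : Set (V → ℝ) :=
  {k | ∑ i, k i = 2 * Real.pi * (eulerChar T : ℝ)}

/-- The coordinates `w i = log (u i)`, as a point of Euclidean space. -/
noncomputable def logCoord (u : V → ℝ) : EuclideanSpace ℝ V :=
  WithLp.toLp 2 fun i => Real.log (u i)

/-- The space of conformal factors in the coordinates `w = log u`. -/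
def logConformalFactors (T : AbstractSimplicialComplex V) (d : Finset V → ℝ) :
    Set (EuclideanSpace ℝ V) :=
  logCoord '' conformalFactors T d

/-- `u` solves the combinatorial Yamabe flow `du i / dt = - u i * K i`, `u i (0) = 1`, on the
time interval `J` (with one-sided derivatives at the end points that belong to `J`). -/
structure IsYamabeFlow (T : AbstractSimplicialComplex V) (d : Finset V → ℝ) (J : Set ℝ)
    (u : ℝ → V → ℝ) : Prop where
  interval : J.OrdConnected
  zero_mem : 0 ∈ J
  mem : ∀ t ∈ J, u t ∈ conformalFactors T d
  deriv : ∀ t ∈ J, ∀ i, HasDerivWithinAt (fun s => u s i) (-(u t i) * curvatureMap T d (u t) i) J t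
  init : ∀ i, u 0 i = 1

/-- `w` solves the negative gradient flow `dw / dt = - ∇ F (w)` on `J`. -/
def IsNegGradientFlow (F : EuclideanSpace ℝ V → ℝ) (J : Set ℝ) (w : ℝ → EuclideanSpace ℝ V) :
    Prop :=
  ∀ t ∈ J, HasDerivWithinAt w (-∇ F (w t)) J t

/-- `F` is locally convex on `W`: each point of `W` has a convex neighbourhood inside `W` on which
`F` is convex. -/
def LocallyConvexOn (W : Set (EuclideanSpace ℝ V)) (F : EuclideanSpace ℝ V → ℝ) : Prop :=
  ∀ w ∈ W, ∃ U ∈ 𝓝 w, U ⊆ W ∧ ConvexOn ℝ U F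

end Conformal

end CombYamabe

/-! In the coordinates `w = log u` the curvature problem splits over triangles. In one triangle the
derivative of the angle at `i` with respect to `w j` is the cotangent of the angle opposite to `ij`.
So the 3×3 angle Jacobian is symmetric and kills constants; completing a square with Heron's formula
shows that it is negative semidefinite with only constants in its kernel
(`IsTriangle.sum_mul_angleDeriv_eq`). Summing over triangles, the Jacobian `L` of `K` in `w` is
symmetric and positive semidefinite, and its kernel is the constants because the surface is
connected and every edge lies in a triangle.

(a) Since `u_j ∂/∂u_j = ∂/∂w_j`, the matrix `c` is `-L`. The flow reads `dw/dt = -K`, so `dK/dt = -L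
K` and `∑ K_i ^ 2` has derivative `-2 ⟨K, L K⟩ ≤ 0`.

(b) An explicit primitive of `∑ K_i dw_i`, assembled from the Lobachevsky function of the angles, is
defined on all of `W`, so nothing about the topology of `W` is needed. Its Hessian is `L`, whence
local convexity.

(c) Gauss-Bonnet confines `K` to a hyperplane. Adding `∑ log u_j` to each component gives a map of
the full space whose derivative is injective, because its quadratic form is `⟨y, L y⟩ + (∑ y_j) ^
2`. The inverse function theorem applies, and this map meets the hyperplane exactly where `∏ u_j =
1`. -/

namespace CombYamabe

/-! ### Heron's formula, the angle sum and the Lobachevsky function. -/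

section TriangleTrigonometry

theorem sixteen_area_sq_pos {x y z : ℝ} (hx : x < y + z) (hy : y < x + z)
    (hz : z < x + y) : 0 < (x ^ 2 + y ^ 2 + z ^ 2) ^ 2 - 2 * (x ^ 4 + y ^ 4 + z ^ 4) := by
  have h : (x ^ 2 + y ^ 2 + z ^ 2) ^ 2 - 2 * (x ^ 4 + y ^ 4 + z ^ 4) =
      (x + y + z) * (x + y - z) * (x + z - y) * (y + z - x) := by ring
  rw [h]
  have h1 : 0 < x + y + z := by linarith
  have h2 : 0 < x + y - z := by linarith
  have h3 : 0 < x + z - y := by linarith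
  have h4 : 0 < y + z - x := by linarith
  positivity

theorem one_sub_cos_sq {x y : ℝ} (z : ℝ) (hx : 0 < x) (hy : 0 < y) :
    1 - ((x ^ 2 + y ^ 2 - z ^ 2) / (2 * (x * y))) ^ 2 =
      ((x ^ 2 + y ^ 2 + z ^ 2) ^ 2 - 2 * (x ^ 4 + y ^ 4 + z ^ 4)) / (2 * (x * y)) ^ 2 := by
  field_simp
  ring

theorem sqrt_one_sub_cos_sq {x y : ℝ} (z : ℝ) (hx : 0 < x) (hy : 0 < y) :
    √(1 - ((x ^ 2 + y ^ 2 - z ^ 2) / (2 * (x * y))) ^ 2) =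
      √((x ^ 2 + y ^ 2 + z ^ 2) ^ 2 - 2 * (x ^ 4 + y ^ 4 + z ^ 4)) / (2 * (x * y)) := by
  rw [one_sub_cos_sq z hx hy, Real.sqrt_div' _ (by positivity), Real.sqrt_sq (by positivity)]

theorem abs_cos_lt_one {x y z : ℝ} (hx0 : 0 < x) (hy0 : 0 < y) (hx : x < y + z) (hy : y < x + z)
    (hz : z < x + y) : |(x ^ 2 + y ^ 2 - z ^ 2) / (2 * (x * y))| < 1 := by
  have h := one_sub_cos_sq z hx0 hy0
  have h2 : 0 < ((x ^ 2 + y ^ 2 + z ^ 2) ^ 2 - 2 * (x ^ 4 + y ^ 4 + z ^ 4)) / (2 * (x * y)) ^ 2 :=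
    div_pos (sixteen_area_sq_pos hx hy hz) (by positivity)
  rw [← sq_lt_one_iff_abs_lt_one]
  linarith

/-- The angles given by the law of cosines add up to `π`. -/
theorem arccos_add_arccos_add_arccos {x y z : ℝ} (hx0 : 0 < x) (hy0 : 0 < y) (hz0 : 0 < z)
    (hx : x < y + z) (hy : y < x + z) (hz : z < x + y) :
    Real.arccos ((x ^ 2 + y ^ 2 - z ^ 2) / (2 * (x * y))) +
      Real.arccos ((x ^ 2 + z ^ 2 - y ^ 2) / (2 * (x * z))) +
      Real.arccos ((y ^ 2 + z ^ 2 - x ^ 2) / (2 * (y * z))) = Real.pi := by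
  have hC := abs_lt.1 (abs_cos_lt_one hx0 hy0 hx hy hz)
  have hB := abs_lt.1 (abs_cos_lt_one hx0 hz0 (by linarith) hz hy)
  have hA := abs_lt.1 (abs_cos_lt_one hy0 hz0 (by linarith) (by linarith) hx)
  have hS := sixteen_area_sq_pos hx hy hz
  have sC := sqrt_one_sub_cos_sq z hx0 hy0
  have sB := sqrt_one_sub_cos_sq y hx0 hz0
  have sA := sqrt_one_sub_cos_sq x hy0 hz0
  rw [show (x ^ 2 + z ^ 2 + y ^ 2) ^ 2 - 2 * (x ^ 4 + z ^ 4 + y ^ 4) =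
    (x ^ 2 + y ^ 2 + z ^ 2) ^ 2 - 2 * (x ^ 4 + y ^ 4 + z ^ 4) by ring] at sB
  rw [show (y ^ 2 + z ^ 2 + x ^ 2) ^ 2 - 2 * (y ^ 4 + z ^ 4 + x ^ 4) =
    (x ^ 2 + y ^ 2 + z ^ 2) ^ 2 - 2 * (x ^ 4 + y ^ 4 + z ^ 4) by ring] at sA
  set S := (x ^ 2 + y ^ 2 + z ^ 2) ^ 2 - 2 * (x ^ 4 + y ^ 4 + z ^ 4) with hSdef
  have hsS : 0 < √S := Real.sqrt_pos.2 hS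
  have hsq : √S ^ 2 = S := Real.sq_sqrt hS.le
  set cC := (x ^ 2 + y ^ 2 - z ^ 2) / (2 * (x * y)) with hcC
  set cB := (x ^ 2 + z ^ 2 - y ^ 2) / (2 * (x * z)) with hcB
  set cA := (y ^ 2 + z ^ 2 - x ^ 2) / (2 * (y * z)) with hcA
  have hcos : Real.cos (Real.arccos cC + Real.arccos cB) = -cA := by
    rw [Real.cos_add, Real.cos_arccos hC.1.le hC.2.le, Real.cos_arccos hB.1.le hB.2.le,
      Real.sin_arccos, Real.sin_arccos, sC, sB, hcC, hcB, hcA]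
    field_simp
    rw [hsq, hSdef]
    ring
  -- The cosine alone does not determine the sum of two angles, which lies in `[0, 2π]`; a positive
  -- sine excludes the part beyond `π`.
  have hsin : 0 < Real.sin (Real.arccos cC + Real.arccos cB) := by
    have : Real.sin (Real.arccos cC + Real.arccos cB) = √S / (2 * (y * z)) := by
      rw [Real.sin_add, Real.cos_arccos hC.1.le hC.2.le, Real.cos_arccos hB.1.le hB.2.le,
        Real.sin_arccos, Real.sin_arccos, sC, sB, hcC, hcB]
      field_simp
      ring
    rw [this]
    positivity
  have hle : Real.arccos cC + Real.arccos cB ≤ Real.pi := by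
    by_contra! h
    have h1 : Real.sin (Real.arccos cC + Real.arccos cB - Real.pi) < 0 := by
      rw [Real.sin_sub_pi]; linarith
    refine absurd h1 (not_lt.2 (Real.sin_nonneg_of_nonneg_of_le_pi (by linarith) ?_))
    linarith [Real.arccos_le_pi cC, Real.arccos_le_pi cB]
  have h := Real.arccos_cos (add_nonneg (Real.arccos_nonneg cC) (Real.arccos_nonneg cB)) hle
  rw [hcos, Real.arccos_neg] at h
  linarith

/-- The Lobachevsky function, up to a linear term. -/
noncomputable def lobachevsky (α : ℝ) : ℝ := -∫ s in (0 : ℝ)..α, Real.log (Real.sin s)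

theorem hasStrictDerivAt_lobachevsky {α : ℝ} (h : Real.sin α ≠ 0) :
    HasStrictDerivAt lobachevsky (-Real.log (Real.sin α)) α := by
  refine HasStrictDerivAt.fun_neg (intervalIntegral.integral_hasStrictDerivAt_right
    intervalIntegrable_log_sin ?_ ?_)
  · exact (Measurable.stronglyMeasurable (by fun_prop)).stronglyMeasurableAtFilter
  · exact (Real.continuousAt_log h).comp (f := Real.sin) Real.continuous_sin.continuousAt

end TriangleTrigonometry

/-! ### Variation of an angle under conformal change. -/

section AngleDerivative

variable {E : Type*} [NormedAddCommGroup E] [NormedSpace ℝ E]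

/-- The derivative of an angle of a triangle whose edge lengths vary conformally. -/
theorem hasStrictFDerivAt_angle {X Y Z : E → ℝ} {a b c : E →L[ℝ] ℝ} {w : E}
    (hX : HasStrictFDerivAt X (X w • (a + b)) w) (hY : HasStrictFDerivAt Y (Y w • (a + c)) w)
    (hZ : HasStrictFDerivAt Z (Z w • (b + c)) w) (hX0 : 0 < X w) (hY0 : 0 < Y w)
    (h1 : X w < Y w + Z w) (h2 : Y w < X w + Z w)
    (h3 : Z w < X w + Y w) :
    HasStrictFDerivAt
      (fun v => Real.arccos ((X v ^ 2 + Y v ^ 2 - Z v ^ 2) / (2 * (X v * Y v))))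
      (((Y w ^ 2 + Z w ^ 2 - X w ^ 2) /
          √((X w ^ 2 + Y w ^ 2 + Z w ^ 2) ^ 2 - 2 * (X w ^ 4 + Y w ^ 4 + Z w ^ 4))) • (b - a) +
        ((X w ^ 2 + Z w ^ 2 - Y w ^ 2) /
          √((X w ^ 2 + Y w ^ 2 + Z w ^ 2) ^ 2 - 2 * (X w ^ 4 + Y w ^ 4 + Z w ^ 4))) • (c - a)) w := by
  have hc := abs_lt.1 (abs_cos_lt_one hX0 hY0 h1 h2 h3)
  have hS := Real.sqrt_pos.2 (sixteen_area_sq_pos h1 h2 h3)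
  have hXY : 2 * (X w * Y w) ≠ 0 := by positivity
  have hq := ((((HasStrictFDerivAt.pow hX 2).add (HasStrictFDerivAt.pow hY 2)).sub
    (HasStrictFDerivAt.pow hZ 2)).mul
    (((hasStrictDerivAt_inv hXY).comp_hasStrictFDerivAt w
      ((HasStrictFDerivAt.mul hX hY).const_mul 2))))
  refine ((Real.hasStrictDerivAt_arccos hc.1.ne' hc.2.ne).comp_hasStrictFDerivAt w hq).congr_fderiv
    ?_
  rw [sqrt_one_sub_cos_sq (Z w) hX0 hY0]
  -- Both sides contain the root only as a common factor `1 / s`, so what is left is a rational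
  -- identity that holds for an opaque `s`.
  set s := √((X w ^ 2 + Y w ^ 2 + Z w ^ 2) ^ 2 - 2 * (X w ^ 4 + Y w ^ 4 + Z w ^ 4))
  ext v
  simp
  field_simp
  ring

end AngleDerivative

/-! ### The angle Jacobian of a single triangle. -/

section FinsetTriangle

variable {V : Type*} [DecidableEq V]

/-- `ℓ` assigns to the edges of the three-element set `t` the lengths of a Euclidean triangle. -/
structure IsTriangle (ℓ : Finset V → ℝ) (t : Finset V) : Prop where
  card : t.card = 3
  pos : ∀ i ∈ t, 0 < ℓ (t.erase i)
  lt : ∀ i ∈ t, ℓ (t.erase i) < ∑ j ∈ t.erase i, ℓ (t.erase j)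

theorem exists_eq_of_card_three {t : Finset V} (ht : t.card = 3) {i : V} (hi : i ∈ t) :
    ∃ j k, i ≠ j ∧ i ≠ k ∧ j ≠ k ∧ t = {i, j, k} := by
  obtain ⟨j, k, hjk, h⟩ := Finset.card_eq_two.1 (by rw [Finset.card_erase_of_mem hi, ht])
  have hi' := Finset.notMem_erase i t
  simp only [h, Finset.mem_insert, Finset.mem_singleton, not_or] at hi'
  exact ⟨j, k, hi'.1, hi'.2, hjk, by rw [← h, Finset.insert_erase hi]⟩

theorem erase_triple {i j k : V} (hij : i ≠ j) (hik : i ≠ k) (hjk : j ≠ k) :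
    ({i, j, k} : Finset V).erase i = {j, k} ∧ ({i, j, k} : Finset V).erase j = {i, k} ∧
      ({i, j, k} : Finset V).erase k = {i, j} := by
  refine ⟨?_, ?_, ?_⟩ <;> grind

theorem sum_triple {M : Type*} [AddCommMonoid M] {i j k : V} (hij : i ≠ j) (hik : i ≠ k)
    (hjk : j ≠ k) (f : V → M) : ∑ m ∈ ({i, j, k} : Finset V), f m = f i + (f j + f k) := by
  rw [Finset.sum_insert (by simp [hij, hik]), Finset.sum_pair hjk]

theorem IsTriangle.triple {ℓ : Finset V → ℝ} {i j k : V} (hij : i ≠ j) (hik : i ≠ k) (hjk : j ≠ k)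
    (h : IsTriangle ℓ {i, j, k}) :
    (0 < ℓ {i, j} ∧ 0 < ℓ {i, k} ∧ 0 < ℓ {j, k}) ∧ ℓ {i, j} < ℓ {i, k} + ℓ {j, k} ∧
      ℓ {i, k} < ℓ {i, j} + ℓ {j, k} ∧ ℓ {j, k} < ℓ {i, j} + ℓ {i, k} := by
  obtain ⟨h1, h2, h3⟩ := erase_triple hij hik hjk
  have pi := h.pos i (by simp)
  have pj := h.pos j (by simp)
  have pk := h.pos k (by simp)
  have li := h.lt i (by simp)
  have lj := h.lt j (by simp)
  have lk := h.lt k (by simp)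
  rw [h1] at pi li
  rw [h2] at pj lj
  rw [h3] at pk lk
  rw [Finset.sum_pair hjk, h2, h3] at li
  rw [Finset.sum_pair hik, h1, h3] at lj
  rw [Finset.sum_pair hij, h1, h2] at lk
  refine ⟨⟨pk, pj, pi⟩, ?_, ?_, ?_⟩ <;> linarith

/-- Four times the area of the triangle `t`, by Heron's formula. -/
noncomputable def fourArea (ℓ : Finset V → ℝ) (t : Finset V) : ℝ :=
  √((∑ m ∈ t, ℓ (t.erase m) ^ 2) ^ 2 - 2 * ∑ m ∈ t, ℓ (t.erase m) ^ 4)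

/-- The cotangent of the angle of the triangle `t` opposite to the edge `e`. -/
noncomputable def cotOpposite (ℓ : Finset V → ℝ) (t e : Finset V) : ℝ :=
  (∑ m ∈ t, ℓ (t.erase m) ^ 2 - 2 * ℓ e ^ 2) / fourArea ℓ t

/-- The derivative of the inner angle of `t` at `i` with respect to the logarithms of the conformal
factors. -/
noncomputable def angleDeriv (ℓ : Finset V → ℝ) (t : Finset V) (i : V) : (V → ℝ) →L[ℝ] ℝ :=
  ∑ j ∈ t.erase i, cotOpposite ℓ t {i, j} •
    (ContinuousLinearMap.proj (R := ℝ) (φ := fun _ : V => ℝ) j - ContinuousLinearMap.proj i)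

theorem fourArea_triple (ℓ : Finset V → ℝ) {i j k : V} (hij : i ≠ j) (hik : i ≠ k) (hjk : j ≠ k) :
    fourArea ℓ {i, j, k} = √((ℓ {i, j} ^ 2 + ℓ {i, k} ^ 2 + ℓ {j, k} ^ 2) ^ 2 -
      2 * (ℓ {i, j} ^ 4 + ℓ {i, k} ^ 4 + ℓ {j, k} ^ 4)) := by
  obtain ⟨h1, h2, h3⟩ := erase_triple hij hik hjk
  rw [fourArea, sum_triple hij hik hjk, sum_triple hij hik hjk, h1, h2, h3]
  congr 1
  ring

theorem IsTriangle.fourArea_pos {ℓ : Finset V → ℝ} {t : Finset V} (h : IsTriangle ℓ t) :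
    0 < fourArea ℓ t := by
  obtain ⟨i, j, k, hij, hik, hjk, rfl⟩ := Finset.card_eq_three.1 h.card
  obtain ⟨-, h1, h2, h3⟩ := h.triple hij hik hjk
  rw [fourArea_triple ℓ hij hik hjk]
  exact Real.sqrt_pos.2 (sixteen_area_sq_pos h1 h2 h3)

theorem cotOpposite_triple (ℓ : Finset V → ℝ) {i j k : V} (hij : i ≠ j) (hik : i ≠ k)
    (hjk : j ≠ k) :
    cotOpposite ℓ {i, j, k} {i, j} =
      (ℓ {i, k} ^ 2 + ℓ {j, k} ^ 2 - ℓ {i, j} ^ 2) / fourArea ℓ {i, j, k} ∧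
    cotOpposite ℓ {i, j, k} {i, k} =
      (ℓ {i, j} ^ 2 + ℓ {j, k} ^ 2 - ℓ {i, k} ^ 2) / fourArea ℓ {i, j, k} ∧
    cotOpposite ℓ {i, j, k} {j, k} =
      (ℓ {i, j} ^ 2 + ℓ {i, k} ^ 2 - ℓ {j, k} ^ 2) / fourArea ℓ {i, j, k} := by
  obtain ⟨h1, h2, h3⟩ := erase_triple hij hik hjk
  simp only [cotOpposite, sum_triple hij hik hjk, h1, h2, h3]
  refine ⟨?_, ?_, ?_⟩ <;> congr 1 <;> ring

theorem angleDeriv_triple (ℓ : Finset V → ℝ) {i j k : V} (hij : i ≠ j) (hik : i ≠ k)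
    (hjk : j ≠ k) (x : V → ℝ) :
    angleDeriv ℓ {i, j, k} i x =
      cotOpposite ℓ {i, j, k} {i, j} * (x j - x i) +
        cotOpposite ℓ {i, j, k} {i, k} * (x k - x i) ∧
    angleDeriv ℓ {i, j, k} j x =
      cotOpposite ℓ {i, j, k} {i, j} * (x i - x j) +
        cotOpposite ℓ {i, j, k} {j, k} * (x k - x j) ∧
    angleDeriv ℓ {i, j, k} k x =
      cotOpposite ℓ {i, j, k} {i, k} * (x i - x k) +
        cotOpposite ℓ {i, j, k} {j, k} * (x j - x k) := by
  obtain ⟨h1, h2, h3⟩ := erase_triple hij hik hjk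
  simp [angleDeriv, h1, h2, h3, hij, hik, hjk, Finset.pair_comm j i,
    Finset.pair_comm k i, Finset.pair_comm k j]

theorem sum_angleDeriv {ℓ : Finset V → ℝ} {t : Finset V} (h : t.card = 3) (x : V → ℝ) :
    ∑ i ∈ t, angleDeriv ℓ t i x = 0 := by
  obtain ⟨i, j, k, hij, hik, hjk, rfl⟩ := Finset.card_eq_three.1 h
  obtain ⟨h1, h2, h3⟩ := angleDeriv_triple ℓ hij hik hjk x
  rw [sum_triple hij hik hjk, h1, h2, h3]
  ring

/-- Both sides are minus the sum, over the edges `ij` of `t`, of the opposite cotangent times `(x i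
- x j) * (y i - y j)`. -/
theorem sum_mul_angleDeriv_comm {ℓ : Finset V → ℝ} {t : Finset V} (h : t.card = 3) (x y : V → ℝ) :
    ∑ i ∈ t, x i * angleDeriv ℓ t i y = ∑ i ∈ t, y i * angleDeriv ℓ t i x := by
  obtain ⟨i, j, k, hij, hik, hjk, rfl⟩ := Finset.card_eq_three.1 h
  obtain ⟨h1, h2, h3⟩ := angleDeriv_triple ℓ hij hik hjk x
  obtain ⟨h1', h2', h3'⟩ := angleDeriv_triple ℓ hij hik hjk y
  rw [sum_triple hij hik hjk, h1', h2', h3', sum_triple hij hik hjk, h1, h2, h3]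
  ring

/-- A completed square for the quadratic form of the angle derivatives. -/
theorem IsTriangle.sum_mul_angleDeriv_eq {ℓ : Finset V → ℝ} {i j k : V} (hij : i ≠ j) (hik : i ≠ k)
    (hjk : j ≠ k) (h : IsTriangle ℓ {i, j, k}) (x : V → ℝ) :
    2 * ℓ {j, k} ^ 2 * fourArea ℓ {i, j, k} *
        -∑ m ∈ ({i, j, k} : Finset V), x m * angleDeriv ℓ {i, j, k} m x =
      (2 * ℓ {j, k} ^ 2 * (x i - x k) -
        (ℓ {j, k} ^ 2 + ℓ {i, k} ^ 2 - ℓ {i, j} ^ 2) * (x j - x k)) ^ 2 +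
      fourArea ℓ {i, j, k} ^ 2 * (x j - x k) ^ 2 := by
  have hA := h.fourArea_pos
  obtain ⟨-, l1, l2, l3⟩ := h.triple hij hik hjk
  have hsq : fourArea ℓ {i, j, k} ^ 2 = (ℓ {i, j} ^ 2 + ℓ {i, k} ^ 2 + ℓ {j, k} ^ 2) ^ 2 -
      2 * (ℓ {i, j} ^ 4 + ℓ {i, k} ^ 4 + ℓ {j, k} ^ 4) := by
    rw [fourArea_triple ℓ hij hik hjk, Real.sq_sqrt (sixteen_area_sq_pos l1 l2 l3).le]
  obtain ⟨h1, h2, h3⟩ := angleDeriv_triple ℓ hij hik hjk x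
  obtain ⟨c1, c2, c3⟩ := cotOpposite_triple ℓ hij hik hjk
  rw [sum_triple hij hik hjk, h1, h2, h3, c1, c2, c3, hsq]
  field_simp
  ring

theorem IsTriangle.sum_mul_angleDeriv_nonpos {ℓ : Finset V → ℝ} {t : Finset V}
    (h : IsTriangle ℓ t) (x : V → ℝ) : ∑ i ∈ t, x i * angleDeriv ℓ t i x ≤ 0 := by
  obtain ⟨i, j, k, hij, hik, hjk, rfl⟩ := Finset.card_eq_three.1 h.card
  have hA := h.fourArea_pos
  obtain ⟨⟨-, -, hp⟩, -⟩ := h.triple hij hik hjk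
  have := h.sum_mul_angleDeriv_eq hij hik hjk x
  rw [← neg_nonneg]
  refine nonneg_of_mul_nonneg_right (a := 2 * ℓ {j, k} ^ 2 * fourArea ℓ {i, j, k}) ?_
    (by positivity)
  rw [this]
  positivity

/-- The square may be completed with respect to any edge `jk`; the second square then carries the
nonzero factor `fourArea` and forces `x j = x k`. -/
theorem IsTriangle.eq_of_sum_mul_angleDeriv_eq_zero {ℓ : Finset V → ℝ} {t : Finset V}
    (h : IsTriangle ℓ t) {x : V → ℝ} (h0 : ∑ i ∈ t, x i * angleDeriv ℓ t i x = 0) {j k : V}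
    (hj : j ∈ t) (hk : k ∈ t) : x j = x k := by
  by_cases hjk : j = k
  · rw [hjk]
  obtain ⟨i, hij, hik, rfl⟩ : ∃ i, i ≠ j ∧ i ≠ k ∧ t = {i, j, k} := by
    obtain ⟨a, b, hja, hjb, hab, rfl⟩ := exists_eq_of_card_three h.card hj
    rcases (by grind : k = a ∨ k = b) with rfl | rfl
    · exact ⟨b, hjb.symm, hab.symm, by grind⟩
    · exact ⟨a, hja.symm, hab, by grind⟩
  have hA := h.fourArea_pos
  have := h.sum_mul_angleDeriv_eq hij hik hjk x
  rw [h0, neg_zero, mul_zero] at this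
  have h2 : fourArea ℓ {i, j, k} ^ 2 * (x j - x k) ^ 2 = 0 :=
    le_antisymm (by nlinarith [sq_nonneg (2 * ℓ {j, k} ^ 2 * (x i - x k) -
        (ℓ {j, k} ^ 2 + ℓ {i, k} ^ 2 - ℓ {i, j} ^ 2) * (x j - x k))]) (by positivity)
  have h3 : x j - x k = 0 := by simpa [hA.ne'] using h2
  linarith

theorem IsTriangle.sum_innerAngle {ℓ : Finset V → ℝ} {t : Finset V} (h : IsTriangle ℓ t) :
    ∑ i ∈ t, innerAngle ℓ t i = Real.pi := by
  obtain ⟨i, j, k, hij, hik, hjk, rfl⟩ := Finset.card_eq_three.1 h.card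
  obtain ⟨⟨p1, p2, p3⟩, l1, l2, l3⟩ := h.triple hij hik hjk
  have ej : ({i, j, k} : Finset V) = {j, i, k} := by grind
  have ek : ({i, j, k} : Finset V) = {k, i, j} := by grind
  rw [sum_triple hij hik hjk, innerAngle_eq ℓ hij hik hjk]
  conv_lhs => rw [ej, innerAngle_eq ℓ hij.symm hjk hik, ← ej, ek,
    innerAngle_eq ℓ hik.symm hjk.symm hij, Finset.pair_comm j i, Finset.pair_comm k i,
    Finset.pair_comm k j]
  rw [← add_assoc]
  exact arccos_add_arccos_add_arccos p1 p2 p3 l1 l2 l3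

/-- Law of sines: the right-hand side is the logarithm of the circumdiameter. Its independence of
`i` is what makes `triangleEnergy` a potential for the angles. -/
theorem IsTriangle.sin_innerAngle {ℓ : Finset V → ℝ} {t : Finset V} (h : IsTriangle ℓ t) {i : V}
    (hi : i ∈ t) :
    0 < Real.sin (innerAngle ℓ t i) ∧
      Real.log (ℓ (t.erase i)) - Real.log (Real.sin (innerAngle ℓ t i)) =
        Real.log (2 * (∏ m ∈ t, ℓ (t.erase m)) / fourArea ℓ t) := by
  have hA := h.fourArea_pos
  obtain ⟨j, k, hij, hik, hjk, rfl⟩ := exists_eq_of_card_three h.card hi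
  obtain ⟨⟨p1, p2, p3⟩, l1, l2, l3⟩ := h.triple hij hik hjk
  obtain ⟨h1, h2, h3⟩ := erase_triple hij hik hjk
  have hs : Real.sin (innerAngle ℓ {i, j, k} i) =
      fourArea ℓ {i, j, k} / (2 * (ℓ {i, j} * ℓ {i, k})) := by
    rw [innerAngle_eq ℓ hij hik hjk, Real.sin_arccos, sqrt_one_sub_cos_sq _ p1 p2,
      fourArea_triple ℓ hij hik hjk]
  rw [hs]
  refine ⟨by positivity, ?_⟩
  rw [← Real.log_div (by rw [h1]; exact p3.ne') (by positivity),
    Finset.prod_insert (by simp [hij, hik]), Finset.prod_pair hjk, h1, h2, h3]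
  congr 1
  field_simp

end FinsetTriangle

/-! ### Lengths, angles and the triangle potential in the coordinates `w`. -/

section LogCoordinates

variable {V : Type*}

/-- The edge lengths `u * d` for `u = exp w`. -/
noncomputable def expLength (d : Finset V → ℝ) (w : V → ℝ) : Finset V → ℝ :=
  conformalChange (fun i => Real.exp (w i)) d

theorem expLength_apply (d : Finset V → ℝ) (w : V → ℝ) (e : Finset V) :
    expLength d w e = Real.exp (∑ v ∈ e, w v) * d e := by
  rw [expLength, conformalChange, Real.exp_sum]

theorem expLength_log (d : Finset V → ℝ) {u : V → ℝ} (hu : ∀ i, 0 < u i) :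
    expLength d (fun i => Real.log (u i)) = conformalChange u d := by
  simp only [expLength, Real.exp_log (hu _)]

theorem log_expLength {d : Finset V → ℝ} {w : V → ℝ} {e : Finset V} (h : 0 < expLength d w e) :
    Real.log (expLength d w e) = ∑ v ∈ e, w v + Real.log (d e) := by
  rw [expLength_apply] at h ⊢
  rw [Real.log_mul (Real.exp_ne_zero _) (right_ne_zero_of_mul h.ne'), Real.log_exp]

variable [Fintype V]

theorem hasStrictFDerivAt_expLength (d : Finset V → ℝ) (e : Finset V) (w : V → ℝ) :
    HasStrictFDerivAt (fun w => expLength d w e)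
      (expLength d w e • ∑ v ∈ e, ContinuousLinearMap.proj (R := ℝ) (φ := fun _ : V => ℝ) v) w := by
  simp only [expLength_apply]
  have h : HasStrictFDerivAt (fun w : V → ℝ => ∑ v ∈ e, w v)
      (∑ v ∈ e, ContinuousLinearMap.proj (R := ℝ) (φ := fun _ : V => ℝ) v) w :=
    HasStrictFDerivAt.fun_sum fun v _ =>
      (ContinuousLinearMap.proj (R := ℝ) (φ := fun _ : V => ℝ) v).hasStrictFDerivAt
  refine (HasStrictFDerivAt.mul_const h.exp (d e)).congr_fderiv ?_
  rw [smul_smul, mul_comm]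

variable [DecidableEq V]

theorem hasStrictFDerivAt_innerAngle (d : Finset V → ℝ) {t : Finset V} {w : V → ℝ}
    (h : IsTriangle (expLength d w) t) {i : V} (hi : i ∈ t) :
    HasStrictFDerivAt (fun w => innerAngle (expLength d w) t i)
      (angleDeriv (expLength d w) t i) w := by
  obtain ⟨j, k, hij, hik, hjk, rfl⟩ := exists_eq_of_card_three h.card hi
  obtain ⟨⟨p1, p2, p3⟩, l1, l2, l3⟩ := h.triple hij hik hjk
  have hX := hasStrictFDerivAt_expLength d {i, j} w
  have hY := hasStrictFDerivAt_expLength d {i, k} w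
  have hZ := hasStrictFDerivAt_expLength d {j, k} w
  rw [Finset.sum_pair hij] at hX
  rw [Finset.sum_pair hik] at hY
  rw [Finset.sum_pair hjk] at hZ
  simp only [innerAngle_eq _ hij hik hjk]
  refine (hasStrictFDerivAt_angle hX hY hZ p1 p2 l1 l2 l3).congr_fderiv ?_
  obtain ⟨c1, c2, c3⟩ := cotOpposite_triple (expLength d w) hij hik hjk
  ext x
  rw [(angleDeriv_triple _ hij hik hjk x).1, c1, c2, fourArea_triple _ hij hik hjk]
  simp

/-- A potential for the inner angles of the triangle `t`. -/
noncomputable def triangleEnergy (d : Finset V → ℝ) (t : Finset V) (w : V → ℝ) : ℝ :=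
  ∑ i ∈ t, (innerAngle (expLength d w) t i * (∑ v ∈ t.erase i, w v + Real.log (d (t.erase i))) +
    lobachevsky (innerAngle (expLength d w) t i) - Real.pi * w i)

/-- The differential of each angle has as coefficient the log of the circumdiameter, the same at all
three vertices, and these differentials sum to zero. What remains is `∑ θ_i (∑_v dw_v - dw_i) - π ∑
dw_i`, and the angle sum `π` cancels all but `-∑ θ_i dw_i`. -/
theorem hasStrictFDerivAt_triangleEnergy (d : Finset V → ℝ) {t : Finset V} {w : V → ℝ}
    (h : IsTriangle (expLength d w) t) :
    HasStrictFDerivAt (triangleEnergy d t)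
      (-∑ i ∈ t, innerAngle (expLength d w) t i •
        ContinuousLinearMap.proj (R := ℝ) (φ := fun _ : V => ℝ) i) w := by
  have hterm : ∀ i ∈ t, HasStrictFDerivAt
      (fun w => innerAngle (expLength d w) t i *
        (∑ v ∈ t.erase i, w v + Real.log (d (t.erase i))) +
          lobachevsky (innerAngle (expLength d w) t i) - Real.pi * w i)
      (innerAngle (expLength d w) t i •
          ∑ v ∈ t.erase i, ContinuousLinearMap.proj (R := ℝ) (φ := fun _ : V => ℝ) v +
        (∑ v ∈ t.erase i, w v + Real.log (d (t.erase i))) • angleDeriv (expLength d w) t i +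
        -Real.log (Real.sin (innerAngle (expLength d w) t i)) • angleDeriv (expLength d w) t i -
        Real.pi • ContinuousLinearMap.proj (R := ℝ) (φ := fun _ : V => ℝ) i) w := by
    intro i hi
    have h1 := hasStrictFDerivAt_innerAngle d h hi
    have h2 : HasStrictFDerivAt (fun w : V → ℝ => ∑ v ∈ t.erase i, w v)
        (∑ v ∈ t.erase i, ContinuousLinearMap.proj (R := ℝ) (φ := fun _ : V => ℝ) v) w :=
      HasStrictFDerivAt.fun_sum fun v _ =>
        (ContinuousLinearMap.proj (R := ℝ) (φ := fun _ : V => ℝ) v).hasStrictFDerivAt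
    have h3 := (hasStrictDerivAt_lobachevsky (h.sin_innerAngle hi).1.ne').comp_hasStrictFDerivAt w h1
    have h4 := (ContinuousLinearMap.proj (R := ℝ) (φ := fun _ : V => ℝ) i).hasStrictFDerivAt
      (x := w) |>.const_mul Real.pi
    exact ((HasStrictFDerivAt.mul h1 (h2.add_const (Real.log (d (t.erase i))))).add h3).sub h4
  have key : HasStrictFDerivAt (triangleEnergy d t) _ w := HasStrictFDerivAt.fun_sum hterm
  refine key.congr_fderiv ?_
  ext x
  have hval : ∀ i ∈ t, innerAngle (expLength d w) t i * ∑ v ∈ t.erase i, x v +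
      (∑ v ∈ t.erase i, w v + Real.log (d (t.erase i))) * angleDeriv (expLength d w) t i x +
      -Real.log (Real.sin (innerAngle (expLength d w) t i)) * angleDeriv (expLength d w) t i x -
      Real.pi * x i =
      innerAngle (expLength d w) t i * ∑ v ∈ t, x v - innerAngle (expLength d w) t i * x i +
      Real.log (2 * (∏ m ∈ t, expLength d w (t.erase m)) / fourArea (expLength d w) t) *
        angleDeriv (expLength d w) t i x - Real.pi * x i := by
    intro i hi
    rw [← (h.sin_innerAngle hi).2, log_expLength (h.pos i hi), ← Finset.add_sum_erase t x hi]
    ring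
  simp only [sum_apply, neg_apply,
    add_apply, sub_apply, smul_apply,
    ContinuousLinearMap.proj_apply, smul_eq_mul]
  refine (Finset.sum_congr rfl hval).trans ?_
  rw [Finset.sum_sub_distrib, Finset.sum_add_distrib, Finset.sum_sub_distrib, ← Finset.sum_mul,
    h.sum_innerAngle, ← Finset.mul_sum, ← Finset.mul_sum, sum_angleDeriv h.card]
  ring

end LogCoordinates

/-! ### Incidence counts and Gauss-Bonnet. -/

section Combinatorics

variable {V : Type*}

theorem mem_of_subset {T : AbstractSimplicialComplex V} {s t : Finset V} (ht : t ∈ T)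
    (hst : s ⊆ t) (hs : s.Nonempty) : s ∈ T :=
  (T.isRelLowerSet_faces ht).2 hst hs

variable [Fintype V]

theorem mem_simplices {T : AbstractSimplicialComplex V} {k : ℕ} {s : Finset V} :
    s ∈ simplices T k ↔ s ∈ T ∧ s.card = k + 1 := by
  simp [simplices]

/-- Every element of `V` is a vertex, since an `AbstractSimplicialComplex` contains all singletons.
-/
theorem card_simplices_zero (T : AbstractSimplicialComplex V) :
    (simplices T 0).card = Fintype.card V := by
  have : simplices T 0 = Finset.univ.map ⟨fun v : V => ({v} : Finset V),
      Finset.singleton_injective⟩ := by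
    ext s
    simp only [mem_simplices, zero_add, Finset.card_eq_one, Finset.mem_map, Finset.mem_univ,
      Function.Embedding.coeFn_mk, true_and]
    constructor
    · rintro ⟨-, v, rfl⟩
      exact ⟨v, rfl⟩
    · rintro ⟨v, rfl⟩
      exact ⟨T.singleton_mem v, v, rfl⟩
  rw [this, Finset.card_map, Finset.card_univ]

theorem hasStrictFDerivAt_log {u : V → ℝ} (hu : ∀ i, 0 < u i) :
    HasStrictFDerivAt (fun (u : V → ℝ) i => Real.log (u i))
      (ContinuousLinearMap.pi fun i =>
        (u i)⁻¹ • ContinuousLinearMap.proj (R := ℝ) (φ := fun _ : V => ℝ) i) u := by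
  refine hasStrictFDerivAt_pi.2 fun i => ?_
  exact (ContinuousLinearMap.proj (R := ℝ) (φ := fun _ : V => ℝ) i).hasStrictFDerivAt.log
    (hu i).ne'

variable [DecidableEq V]

theorem erase_mem_simplices {T : AbstractSimplicialComplex V} {t : Finset V}
    (ht : t ∈ simplices T 2) {i : V} (hi : i ∈ t) : t.erase i ∈ simplices T 1 := by
  rw [mem_simplices] at ht ⊢
  have hc : (t.erase i).card = 2 := by rw [Finset.card_erase_of_mem hi, ht.2]
  exact ⟨mem_of_subset ht.1 (Finset.erase_subset i t) (Finset.card_pos.1 (by omega)), hc⟩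

theorem IsPLMetric.isTriangle {T : AbstractSimplicialComplex V} {ℓ : Finset V → ℝ}
    (h : IsPLMetric T ℓ) {t : Finset V} (ht : t ∈ simplices T 2) : IsTriangle ℓ t where
  card := (mem_simplices.1 ht).2
  pos _ hi := h.pos _ (erase_mem_simplices ht hi)
  lt := h.triangle t ht

theorem sum_sum_filter_mem {M : Type*} [AddCommMonoid M] (S : Finset (Finset V))
    (f : Finset V → V → M) : ∑ i, ∑ t ∈ S with i ∈ t, f t i = ∑ t ∈ S, ∑ i ∈ t, f t i :=
  Finset.sum_comm' (by simp [and_comm])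

/-- Each edge of a closed surface lies in exactly two triangles. -/
theorem IsClosedSurface.card_triangles_of_edge {T : AbstractSimplicialComplex V}
    (hT : IsClosedSurface T) {e : Finset V} (he : e ∈ simplices T 1) :
    ((simplices T 2).filter fun t => e ⊆ t).card = 2 := by
  rw [mem_simplices] at he
  obtain ⟨v, w, hvw, rfl⟩ := Finset.card_eq_two.1 he.2
  refine Eq.trans ?_ (hT.link_two_regular v ⟨w, hvw.symm, he.1⟩)
  rw [← Set.ncard_coe_finset]
  symm
  -- Neighbours `a` of `w` in the link of `v` correspond to the triangles `vwa`.
  refine Set.ncard_congr (fun a _ => {v, w, a.1}) ?_ ?_ ?_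
  · rintro ⟨a, hav, hva⟩ ⟨hne, hmem⟩
    have hwa : w ≠ a := fun h => hne (Subtype.ext h)
    simp only [Finset.coe_filter, Set.mem_ofPred_eq, mem_simplices]
    refine ⟨⟨hmem, ?_⟩, by grind⟩
    rw [Finset.card_insert_of_notMem (by grind), Finset.card_pair hwa]
  · rintro ⟨a, hav, hva⟩ ⟨b, hbv, hvb⟩ ⟨hna, -⟩ ⟨hnb, -⟩ h
    have hwa : w ≠ a := fun h => hna (Subtype.ext h)
    have : a ∈ ({v, w, b} : Finset V) := by
      rw [← h]; simp
    have hab : a = b := by grind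
    exact Subtype.ext hab
  · intro t ht
    simp only [Finset.coe_filter, Set.mem_ofPred_eq, mem_simplices] at ht
    obtain ⟨⟨ht, hc⟩, hs⟩ := ht
    obtain ⟨j, k, hj, hk, hjk, rfl⟩ := exists_eq_of_card_three hc (hs (Finset.mem_insert_self v _))
    obtain ⟨a, hwa, hva, h⟩ : ∃ a, w ≠ a ∧ a ≠ v ∧ ({v, j, k} : Finset V) = {v, w, a} := by
      have hw : w ∈ ({v, j, k} : Finset V) := hs (by simp)
      rcases (by grind : w = j ∨ w = k) with rfl | rfl
      · exact ⟨k, hjk, hk.symm, rfl⟩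
      · exact ⟨j, hjk.symm, hj.symm, by grind⟩
    rw [h] at ht ⊢
    exact ⟨⟨a, hva, mem_of_subset ht (by grind) (by simp)⟩,
      ⟨fun h' => hwa (Subtype.ext_iff.1 h'), ht⟩, rfl⟩

theorem IsClosedSurface.exists_triangle {T : AbstractSimplicialComplex V}
    (hT : IsClosedSurface T) {v w : V} (hvw : v ≠ w) (h : {v, w} ∈ T) :
    ∃ t ∈ simplices T 2, v ∈ t ∧ w ∈ t := by
  have := hT.card_triangles_of_edge (mem_simplices.2 ⟨h, Finset.card_pair hvw⟩)
  obtain ⟨t, ht⟩ := Finset.card_pos.1 (this.symm ▸ two_pos)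
  rw [Finset.mem_filter] at ht
  exact ⟨t, ht.1, ht.2 (by simp), ht.2 (by simp)⟩

theorem card_edges_of_triangle {T : AbstractSimplicialComplex V} {t : Finset V}
    (ht : t ∈ simplices T 2) : ((simplices T 1).filter fun e => e ⊆ t).card = 3 := by
  have : ((simplices T 1).filter fun e => e ⊆ t) = t.powersetCard 2 := by
    ext e
    rw [Finset.mem_filter, mem_simplices, Finset.mem_powersetCard]
    constructor
    · rintro ⟨⟨-, h⟩, h'⟩
      exact ⟨h', h⟩
    · rintro ⟨h', h⟩
      exact ⟨⟨mem_of_subset (mem_simplices.1 ht).1 h' (Finset.card_pos.1 (by omega)), h⟩, h'⟩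
  rw [this, Finset.card_powersetCard, (mem_simplices.1 ht).2]
  rfl

/-- Double counting of the incident pairs of an edge and a triangle. -/
theorem IsClosedSurface.two_mul_card_edges {T : AbstractSimplicialComplex V}
    (hT : IsClosedSurface T) : 2 * (simplices T 1).card = 3 * (simplices T 2).card := by
  have h := Finset.sum_card_bipartiteAbove_eq_sum_card_bipartiteBelow
    (s := simplices T 1) (t := simplices T 2) (fun e t => e ⊆ t)
  have h2 : ∑ e ∈ simplices T 1, ((simplices T 2).filter fun t => e ⊆ t).card =
      (simplices T 1).card * 2 := by
    rw [Finset.sum_congr rfl fun e he => hT.card_triangles_of_edge he, Finset.sum_const,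
      smul_eq_mul]
  have h3 : ∑ t ∈ simplices T 2, ((simplices T 1).filter fun e => e ⊆ t).card =
      (simplices T 2).card * 3 := by
    rw [Finset.sum_congr rfl fun t ht => card_edges_of_triangle ht, Finset.sum_const, smul_eq_mul]
  have h4 := h2.symm.trans (h.trans h3)
  omega

/-- The combinatorial Gauss-Bonnet theorem. -/
theorem IsClosedSurface.sum_curvature {T : AbstractSimplicialComplex V}
    (hT : IsClosedSurface T) {ℓ : Finset V → ℝ} (h : IsPLMetric T ℓ) :
    ∑ i, curvature T ℓ i = 2 * Real.pi * (eulerChar T : ℝ) := by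
  have h1 : ∑ i, curvature T ℓ i =
      2 * Real.pi * Fintype.card V - (simplices T 2).card * Real.pi := by
    simp only [curvature]
    rw [Finset.sum_sub_distrib, sum_sum_filter_mem,
      Finset.sum_congr rfl fun t ht => (h.isTriangle ht).sum_innerAngle]
    simp [mul_comm]
  -- The angle sums leave `2πV - πF`, and `2E = 3F` turns `-F/2` into `-E + F`.
  have h2 : (2 * (simplices T 1).card : ℝ) = 3 * (simplices T 2).card := by
    exact_mod_cast hT.two_mul_card_edges
  rw [h1, eulerChar, card_simplices_zero]
  push_cast
  linear_combination Real.pi * h2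

end Combinatorics

/-! ### The Jacobian of the curvature and its kernel. -/

section CurvatureDerivative

variable {V : Type*} [Fintype V] [DecidableEq V]

/-- The derivative of the curvature with respect to the logarithms of the conformal factors. -/
noncomputable def curvatureDeriv (T : AbstractSimplicialComplex V) (ℓ : Finset V → ℝ) :
    (V → ℝ) →L[ℝ] (V → ℝ) :=
  ContinuousLinearMap.pi fun i => -∑ t ∈ simplices T 2 with i ∈ t, angleDeriv ℓ t i

variable {T : AbstractSimplicialComplex V}

theorem sum_mul_curvatureDeriv (ℓ : Finset V → ℝ) (x y : V → ℝ) :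
    ∑ i, x i * curvatureDeriv T ℓ y i = -∑ t ∈ simplices T 2, ∑ i ∈ t, x i * angleDeriv ℓ t i y := by
  rw [← sum_sum_filter_mem, ← Finset.sum_neg_distrib]
  refine Finset.sum_congr rfl fun i _ => ?_
  simp [curvatureDeriv, Finset.mul_sum]

theorem sum_mul_curvatureDeriv_comm (ℓ : Finset V → ℝ) (x y : V → ℝ) :
    ∑ i, x i * curvatureDeriv T ℓ y i = ∑ i, y i * curvatureDeriv T ℓ x i := by
  rw [sum_mul_curvatureDeriv, sum_mul_curvatureDeriv]
  congr 1
  exact Finset.sum_congr rfl fun t ht => sum_mul_angleDeriv_comm (mem_simplices.1 ht).2 x y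

theorem IsPLMetric.sum_mul_curvatureDeriv_nonneg {ℓ : Finset V → ℝ} (h : IsPLMetric T ℓ)
    (x : V → ℝ) : 0 ≤ ∑ i, x i * curvatureDeriv T ℓ x i := by
  rw [sum_mul_curvatureDeriv, neg_nonneg]
  exact Finset.sum_nonpos fun t ht => (h.isTriangle ht).sum_mul_angleDeriv_nonpos x

/-- The form is a sum of terms of one sign, so each vanishes and `x` is constant on every triangle.
Every edge lies in a triangle, so `x` is constant along paths of the 1-skeleton. -/
theorem IsPLMetric.eq_of_sum_mul_curvatureDeriv_eq_zero (hT : IsClosedSurface T)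
    {ℓ : Finset V → ℝ} (h : IsPLMetric T ℓ) {x : V → ℝ}
    (h0 : ∑ i, x i * curvatureDeriv T ℓ x i = 0) (v w : V) : x v = x w := by
  rw [sum_mul_curvatureDeriv, neg_eq_zero,
    Finset.sum_eq_zero_iff_of_nonpos fun t ht => (h.isTriangle ht).sum_mul_angleDeriv_nonpos x] at h0
  obtain ⟨p⟩ := hT.connected.preconnected v w
  induction p with
  | nil => rfl
  | cons hadj _ ih =>
    obtain ⟨t, ht, hv, hw⟩ := hT.exists_triangle hadj.1 hadj.2
    exact ((h.isTriangle ht).eq_of_sum_mul_angleDeriv_eq_zero (h0 t ht) hv hw).trans ih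

theorem hasStrictFDerivAt_curvature {d : Finset V → ℝ} {w : V → ℝ}
    (h : IsPLMetric T (expLength d w)) :
    HasStrictFDerivAt (fun w => curvature T (expLength d w))
      (curvatureDeriv T (expLength d w)) w := by
  refine hasStrictFDerivAt_pi.2 fun i => ?_
  refine (HasStrictFDerivAt.fun_sum (u := (simplices T 2).filter fun t => i ∈ t)
    fun t ht => ?_).const_sub (2 * Real.pi)
  rw [Finset.mem_filter] at ht
  exact hasStrictFDerivAt_innerAngle d (h.isTriangle ht.1) ht.2

theorem isOpen_conformalFactors (T : AbstractSimplicialComplex V) (d : Finset V → ℝ) :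
    IsOpen (conformalFactors T d) := by
  have : conformalFactors T d = (⋂ i, {u : V → ℝ | 0 < u i}) ∩
      ((⋂ e ∈ simplices T 1, {u : V → ℝ | 0 < conformalChange u d e}) ∩
        ⋂ t ∈ simplices T 2, ⋂ i ∈ t, {u : V → ℝ | conformalChange u d (t.erase i) <
          ∑ j ∈ t.erase i, conformalChange u d (t.erase j)}) := by
    ext u
    simp only [conformalFactors, Set.mem_ofPred_eq, Set.mem_inter_iff, Set.mem_iInter]
    exact ⟨fun h => ⟨h.1, h.2.pos, h.2.triangle⟩, fun h => ⟨h.1, h.2.1, h.2.2⟩⟩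
  rw [this]
  have hc : ∀ e, Continuous fun u : V → ℝ => conformalChange u d e := fun e => by
    unfold conformalChange
    fun_prop
  refine (isOpen_iInter_of_finite fun i => isOpen_lt continuous_const (continuous_apply i)).inter
    (IsOpen.inter ?_ ?_)
  · exact isOpen_biInter_finset fun e _ => isOpen_lt continuous_const (hc e)
  · exact isOpen_biInter_finset fun t _ => isOpen_biInter_finset fun i _ =>
      isOpen_lt (hc _) (continuous_finsetSum _ fun j _ => hc _)

theorem hasStrictFDerivAt_curvatureMap {d : Finset V → ℝ} {u : V → ℝ}
    (hu : u ∈ conformalFactors T d) :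
    HasStrictFDerivAt (curvatureMap T d) (curvatureDeriv T (conformalChange u d) ∘L
      ContinuousLinearMap.pi fun i =>
        (u i)⁻¹ • ContinuousLinearMap.proj (R := ℝ) (φ := fun _ : V => ℝ) i) u := by
  have he := expLength_log d hu.1
  have h := hasStrictFDerivAt_curvature (T := T) (d := d) (w := fun i => Real.log (u i))
    (he.symm ▸ hu.2)
  rw [he] at h
  -- `exp (log u) = u` needs positivity, which holds near `u` because the set of conformal factors
  -- is open.
  refine (h.comp u (hasStrictFDerivAt_log hu.1)).congr_of_eventuallyEq ?_
  filter_upwards [(isOpen_conformalFactors T d).mem_nhds hu] with v hv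
  simp only [expLength_log d hv.1, curvatureMap]

end CurvatureDerivative

/-! ### Convexity, componentwise derivatives and local homeomorphisms of subspaces. -/

section Analysis

/-- Reduction to the one-variable criterion on each segment from `x` to `y`. -/
theorem convexOn_of_hasFDerivAt2_nonneg {E : Type*} [NormedAddCommGroup E] [NormedSpace ℝ E]
    {s : Set E} (hs : Convex ℝ s) {f : E → ℝ} {f' : E → E →L[ℝ] ℝ} {f'' : E → E → E →L[ℝ] ℝ}
    (h1 : ∀ x ∈ s, HasFDerivAt f (f' x) x)
    (h2 : ∀ x ∈ s, ∀ v, HasFDerivAt (fun y => f' y v) (f'' x v) x)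
    (h3 : ∀ x ∈ s, ∀ v, 0 ≤ f'' x v v) : ConvexOn ℝ s f := by
  refine ⟨hs, fun x hx y hy a b ha hb hab => ?_⟩
  have hmem : ∀ r ∈ Set.Icc (0 : ℝ) 1, x + r • (y - x) ∈ s := fun r hr =>
    hs.add_smul_sub_mem hx hy hr
  have hline : ∀ r : ℝ, HasDerivAt (fun r : ℝ => x + r • (y - x)) (y - x) r := fun r => by
    simpa using ((hasDerivAt_id r).smul_const (y - x)).const_add x
  have hd : ∀ r ∈ Set.Icc (0 : ℝ) 1, HasDerivAt (fun r : ℝ => f (x + r • (y - x)))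
      (f' (x + r • (y - x)) (y - x)) r := fun r hr =>
    (h1 _ (hmem r hr)).comp_hasDerivAt r (hline r)
  have hc : ConvexOn ℝ (Set.Icc (0 : ℝ) 1) (fun r : ℝ => f (x + r • (y - x))) := by
    refine convexOn_of_hasDerivWithinAt2_nonneg (convex_Icc 0 1)
      (f' := fun r => f' (x + r • (y - x)) (y - x))
      (f'' := fun r => f'' (x + r • (y - x)) (y - x) (y - x))
      (fun r hr => (hd r hr).continuousAt.continuousWithinAt)
      (fun r hr => (hd r (interior_subset hr)).hasDerivWithinAt)
      (fun r hr => ?_) (fun r hr => h3 _ (hmem r (interior_subset hr)) _)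
    exact ((h2 _ (hmem r (interior_subset hr)) (y - x)).comp_hasDerivAt r
      (hline r)).hasDerivWithinAt
  have := hc.2 (Set.left_mem_Icc.2 zero_le_one) (Set.right_mem_Icc.2 zero_le_one) ha hb hab
  have e : x + b • (y - x) = a • x + b • y := by
    rw [← eq_sub_iff_add_eq] at hab
    rw [hab]
    module
  simpa [e] using this

theorem hasDerivWithinAt_euclideanSpace {ι : Type*} [Fintype ι] {w : ℝ → EuclideanSpace ℝ ι}
    {w' : EuclideanSpace ℝ ι} {J : Set ℝ} {t : ℝ} :
    HasDerivWithinAt w w' J t ↔ ∀ i, HasDerivWithinAt (fun s => w s i) (w' i) J t := by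
  constructor
  · intro h i
    exact (EuclideanSpace.proj (𝕜 := ℝ) i).hasFDerivAt.comp_hasDerivWithinAt t h
  · intro h
    have h' : HasDerivWithinAt (fun s i => w s i) (fun i => w' i) J t := hasDerivWithinAt_pi.2 h
    exact (EuclideanSpace.equiv ι ℝ).symm.toContinuousLinearMap.hasFDerivAt.comp_hasDerivWithinAt
      t h'

/-- A map between subspaces is a local homeomorphism if near each point it is the restriction of a
local homeomorphism of the ambient spaces that identifies the subspaces. -/
theorem isLocalHomeomorph_of_openPartialHomeomorph {X Y : Type*} [TopologicalSpace X]
    [TopologicalSpace Y] {A : Set X} {B : Set Y} {f : A → B}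
    (h : ∀ x : A, ∃ e : OpenPartialHomeomorph X Y, x.1 ∈ e.source ∧
      (∀ y : A, y.1 ∈ e.source → e y.1 = (f y).1) ∧ ∀ z ∈ e.source, e z ∈ B → z ∈ A) :
    IsLocalHomeomorph f := by
  refine isLocalHomeomorph_iff_isOpenEmbedding_restrict.2 fun x => ?_
  obtain ⟨e, hx, hef, heA⟩ := h x
  set U : Set A := Subtype.val ⁻¹' e.source with hU
  have hUo : IsOpen U := e.open_source.preimage continuous_subtype_val
  refine ⟨U, hUo.mem_nhds hx, ?_⟩
  let ι : U → e.source := fun y => ⟨y.1.1, y.2⟩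
  have hι : Topology.IsEmbedding ι :=
    (Topology.IsEmbedding.subtypeVal.comp Topology.IsEmbedding.subtypeVal).codRestrict _ _
  have hcomp : (Subtype.val ∘ U.domRestrict f : U → Y) = e.source.domRestrict e ∘ ι := by
    funext y
    exact (hef y.1 y.2).symm
  have hemb : Topology.IsEmbedding (Subtype.val ∘ U.domRestrict f : U → Y) := by
    rw [hcomp]
    exact e.isOpenEmbedding_restrict.isEmbedding.comp hι
  refine ⟨⟨?_, ?_⟩, ?_⟩
  · refine (Topology.IsInducing.of_comp_iff Topology.IsInducing.subtypeVal).1 hemb.isInducing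
  · exact Function.Injective.of_comp hemb.injective
  -- The image is relatively open: a point of `B` in the target of `e` has its `e`-preimage in `A`,
  -- by the last hypothesis on `e`.
  · have : Set.range (U.domRestrict f) = Subtype.val ⁻¹' e.target := by
      ext b
      constructor
      · rintro ⟨y, rfl⟩
        have := e.map_source y.2
        rwa [hef y.1 y.2] at this
      · intro hb
        have hs := e.map_target hb
        have hA := heA _ hs (by rw [e.right_inv hb]; exact b.2)
        refine ⟨⟨⟨e.symm b.1, hA⟩, hs⟩, Subtype.ext ?_⟩
        exact (hef ⟨e.symm b.1, hA⟩ hs).symm.trans (e.right_inv hb)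
    rw [this]
    exact e.open_target.preimage continuous_subtype_val

theorem sum_log_eq_zero_iff {V : Type*} [Fintype V] {u : V → ℝ} (hu : ∀ i, 0 < u i) :
    ∑ j, Real.log (u j) = 0 ↔ ∏ j, u j = 1 := by
  rw [← Real.log_prod fun i _ => (hu i).ne']
  have hp : 0 < ∏ j, u j := Finset.prod_pos fun i _ => hu i
  exact ⟨Real.eq_one_of_pos_of_log_eq_zero hp, fun h => by rw [h, Real.log_one]⟩

end Analysis

/-! ### Evolution of the curvature under the flow. -/

section HeatEquation

variable {V : Type*} [Fintype V] [DecidableEq V] {T : AbstractSimplicialComplex V}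
  {d : Finset V → ℝ}

/-- The matrix `-u_j ∂K_i/∂u_j`. -/
noncomputable def heatMatrix (T : AbstractSimplicialComplex V) (ℓ : Finset V → ℝ) : Matrix V V ℝ :=
  -LinearMap.toMatrix' (curvatureDeriv T ℓ : (V → ℝ) →ₗ[ℝ] (V → ℝ))

theorem heatMatrix_mulVec (ℓ : Finset V → ℝ) (x : V → ℝ) :
    (heatMatrix T ℓ).mulVec x = -curvatureDeriv T ℓ x := by
  rw [heatMatrix, Matrix.neg_mulVec, LinearMap.toMatrix'_mulVec]
  rfl

theorem heatMatrix_apply (ℓ : Finset V → ℝ) (i j : V) :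
    heatMatrix T ℓ i j = -curvatureDeriv T ℓ (Pi.single j 1) i := by
  rw [heatMatrix, Matrix.neg_apply, LinearMap.toMatrix'_apply]
  simp [Pi.single]

theorem isSymm_heatMatrix (ℓ : Finset V → ℝ) : (heatMatrix T ℓ).IsSymm := by
  refine Matrix.IsSymm.ext fun i j => ?_
  have := sum_mul_curvatureDeriv_comm (T := T) ℓ (Pi.single i 1) (Pi.single j 1)
  rw [heatMatrix_apply, heatMatrix_apply]
  simpa [Pi.single_apply] using this.symm

theorem IsPLMetric.posSemidef_neg_heatMatrix {ℓ : Finset V → ℝ} (h : IsPLMetric T ℓ) :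
    (-heatMatrix T ℓ).PosSemidef := by
  refine Matrix.PosSemidef.of_dotProduct_mulVec_nonneg ?_ fun x => ?_
  · rw [Matrix.IsHermitian, Matrix.conjTranspose_eq_transpose_of_trivial, Matrix.transpose_neg,
      (isSymm_heatMatrix ℓ).eq]
  · rw [Matrix.neg_mulVec, heatMatrix_mulVec, neg_neg]
    exact h.sum_mul_curvatureDeriv_nonneg x

theorem hasDerivAt_curvatureMap_update {u : V → ℝ} (hu : u ∈ conformalFactors T d) (i j : V) :
    HasDerivAt (fun s => curvatureMap T d (Function.update u j s) i)
      (-(heatMatrix T (conformalChange u d) i j) / u j) (u j) := by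
  have h := (hasStrictFDerivAt_curvatureMap hu).hasFDerivAt
  have h2 := h.comp_hasDerivAt_of_eq (u j) (hasDerivAt_update u j (u j))
    (Function.update_eq_self j u).symm
  have h3 := hasDerivAt_pi.1 h2 i
  refine h3.congr_deriv ?_
  -- The differential of `log` scales the `j`-th basis vector by `1 / u j`; this is the divisor in
  -- the statement.
  have : (ContinuousLinearMap.pi fun i =>
      (u i)⁻¹ • ContinuousLinearMap.proj (R := ℝ) (φ := fun _ : V => ℝ) i) (Pi.single j 1) =
      (u j)⁻¹ • (Pi.single j 1 : V → ℝ) := by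
    ext k
    by_cases hk : k = j
    · subst hk; simp
    · simp [hk]
  rw [ContinuousLinearMap.comp_apply, this, map_smul, heatMatrix_apply, neg_neg, Pi.smul_apply,
    smul_eq_mul, div_eq_inv_mul]

theorem IsYamabeFlow.hasDerivWithinAt_curvatureMap {J : Set ℝ} {u : ℝ → V → ℝ}
    (hu : IsYamabeFlow T d J u) {t : ℝ} (ht : t ∈ J) (i : V) :
    HasDerivWithinAt (fun s => curvatureMap T d (u s) i)
      (∑ j, heatMatrix T (conformalChange (u t) d) i j * curvatureMap T d (u t) j) J t := by
  have h := (hasStrictFDerivAt_curvatureMap (hu.mem t ht)).hasFDerivAt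
  have h2 := h.comp_hasDerivWithinAt t (hasDerivWithinAt_pi.2 (hu.deriv t ht))
  refine (hasDerivWithinAt_pi.1 h2 i).congr_deriv ?_
  -- In the coordinates `log u` the velocity of the flow is `-K`.
  have : (ContinuousLinearMap.pi fun i =>
      (u t i)⁻¹ • ContinuousLinearMap.proj (R := ℝ) (φ := fun _ : V => ℝ) i)
        (fun i => -(u t i) * curvatureMap T d (u t) i) = -curvatureMap T d (u t) := by
    ext k
    have := (hu.mem t ht).1 k
    simp
    field_simp
  rw [ContinuousLinearMap.comp_apply, this, map_neg, ← heatMatrix_mulVec]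
  rfl

theorem IsYamabeFlow.antitoneOn_sum_sq {J : Set ℝ} {u : ℝ → V → ℝ}
    (hu : IsYamabeFlow T d J u) :
    AntitoneOn (fun t => ∑ i, curvatureMap T d (u t) i ^ 2) J := by
  have hd : ∀ t ∈ J, HasDerivWithinAt (fun t => ∑ i, curvatureMap T d (u t) i ^ 2)
      (-2 * ∑ i, curvatureMap T d (u t) i *
        curvatureDeriv T (conformalChange (u t) d) (curvatureMap T d (u t)) i) J t := by
    intro t ht
    refine (HasDerivWithinAt.fun_sum (u := Finset.univ) fun i _ =>
      (hu.hasDerivWithinAt_curvatureMap ht i).fun_pow 2).congr_deriv ?_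
    rw [Finset.mul_sum]
    refine Finset.sum_congr rfl fun i _ => ?_
    have := congrFun (heatMatrix_mulVec (T := T) (conformalChange (u t) d)
      (curvatureMap T d (u t))) i
    rw [Matrix.mulVec, dotProduct] at this
    rw [this]
    simp
    ring
  refine antitoneOn_of_hasDerivWithinAt_nonpos hu.interval.convex
    (fun t ht => (hd t ht).continuousWithinAt)
    (fun t ht => (hd t (interior_subset ht)).mono interior_subset) fun t ht => ?_
  have := (hu.mem t (interior_subset ht)).2.sum_mul_curvatureDeriv_nonneg (curvatureMap T d (u t))
  linarith

end HeatEquation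

/-! ### The potential of the curvature and the gradient flow. -/

section Energy

variable {V : Type*} [Fintype V] [DecidableEq V] {T : AbstractSimplicialComplex V}
  {d : Finset V → ℝ}

/-- A function of `w = log u` whose gradient is the curvature of `u * d`. -/
noncomputable def curvatureEnergy (T : AbstractSimplicialComplex V) (d : Finset V → ℝ)
    (w : V → ℝ) : ℝ :=
  2 * Real.pi * ∑ i, w i + ∑ t ∈ simplices T 2, triangleEnergy d t w

theorem hasStrictFDerivAt_curvatureEnergy {w : V → ℝ} (h : IsPLMetric T (expLength d w)) :
    HasStrictFDerivAt (curvatureEnergy T d)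
      (∑ i, curvature T (expLength d w) i •
        ContinuousLinearMap.proj (R := ℝ) (φ := fun _ : V => ℝ) i) w := by
  have h1 : HasStrictFDerivAt (fun w : V → ℝ => ∑ i, w i)
      (∑ i, ContinuousLinearMap.proj (R := ℝ) (φ := fun _ : V => ℝ) i) w :=
    HasStrictFDerivAt.fun_sum fun i _ =>
      (ContinuousLinearMap.proj (R := ℝ) (φ := fun _ : V => ℝ) i).hasStrictFDerivAt
  have h2 : HasStrictFDerivAt (fun w => ∑ t ∈ simplices T 2, triangleEnergy d t w) _ w :=
    HasStrictFDerivAt.fun_sum fun t ht => hasStrictFDerivAt_triangleEnergy d (h.isTriangle ht)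
  refine ((h1.const_mul (2 * Real.pi)).add h2).congr_fderiv ?_
  rw [Finset.sum_neg_distrib, ← sum_sum_filter_mem, ← sub_eq_add_neg, Finset.smul_sum,
    ← Finset.sum_sub_distrib]
  refine Finset.sum_congr rfl fun i _ => ?_
  ext x
  simp [curvature, sub_mul, Finset.sum_mul]

theorem exp_mem_conformalFactors {w : V → ℝ} :
    (fun i => Real.exp (w i)) ∈ conformalFactors T d ↔ IsPLMetric T (expLength d w) :=
  ⟨fun h => h.2, fun h => ⟨fun _ => Real.exp_pos _, h⟩⟩

theorem isOpen_setOf_isPLMetric_expLength (T : AbstractSimplicialComplex V) (d : Finset V → ℝ) :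
    IsOpen {w : V → ℝ | IsPLMetric T (expLength d w)} := by
  have : {w : V → ℝ | IsPLMetric T (expLength d w)} =
      (fun w i => Real.exp (w i)) ⁻¹' conformalFactors T d := by
    ext w
    exact exp_mem_conformalFactors.symm
  rw [this]
  exact (isOpen_conformalFactors T d).preimage (by fun_prop)

/-- The gradient is the curvature, so the Hessian is `curvatureDeriv`, which is positive
semidefinite. -/
theorem convexOn_curvatureEnergy {s : Set (V → ℝ)} (hs : Convex ℝ s)
    (h : ∀ w ∈ s, IsPLMetric T (expLength d w)) : ConvexOn ℝ s (curvatureEnergy T d) := by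
  refine convexOn_of_hasFDerivAt2_nonneg hs
    (fun w hw => (hasStrictFDerivAt_curvatureEnergy (h w hw)).hasFDerivAt)
    (f'' := fun w x => ∑ i, x i • (ContinuousLinearMap.proj (R := ℝ) (φ := fun _ : V => ℝ) i ∘L
      curvatureDeriv T (expLength d w))) (fun w hw x => ?_) fun w hw x => ?_
  · have hK := hasFDerivAt_pi'.1 (hasStrictFDerivAt_curvature (h w hw)).hasFDerivAt
    refine (HasFDerivAt.fun_sum (u := Finset.univ) fun i _ =>
      (hK i).const_mul (x i)).congr_of_eventuallyEq (Filter.Eventually.of_forall fun y => ?_)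
    simp [mul_comm]
  · simpa using (h w hw).sum_mul_curvatureDeriv_nonneg x

theorem logConformalFactors_eq (T : AbstractSimplicialComplex V) (d : Finset V → ℝ) :
    logConformalFactors T d = {w | IsPLMetric T (expLength d w.ofLp)} := by
  ext w
  constructor
  · rintro ⟨u, hu, rfl⟩
    have := hu.2
    rwa [← expLength_log d hu.1] at this
  · intro hw
    exact ⟨_, exp_mem_conformalFactors.2 hw, by ext i; simp [logCoord]⟩

theorem locallyConvexOn_curvatureEnergy (T : AbstractSimplicialComplex V) (d : Finset V → ℝ) :
    LocallyConvexOn (logConformalFactors T d) fun w => curvatureEnergy T d w.ofLp := by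
  rw [logConformalFactors_eq]
  intro w hw
  obtain ⟨r, hr, hball⟩ := Metric.isOpen_iff.1 (isOpen_setOf_isPLMetric_expLength T d) w.ofLp hw
  -- A sup-norm ball, pulled back to Euclidean space by a linear homeomorphism, remains a convex
  -- neighbourhood.
  refine ⟨(EuclideanSpace.equiv V ℝ) ⁻¹' Metric.ball w.ofLp r, ?_, fun v hv => hball hv, ?_⟩
  · exact (EuclideanSpace.equiv V ℝ).continuous.continuousAt.preimage_mem_nhds
      (Metric.ball_mem_nhds _ hr)
  · exact (convexOn_curvatureEnergy (convex_ball w.ofLp r) fun v hv => hball hv).comp_linearMap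
      (EuclideanSpace.equiv V ℝ : EuclideanSpace ℝ V →ₗ[ℝ] V → ℝ)

theorem hasGradientAt_curvatureEnergy {u : V → ℝ} (hu : u ∈ conformalFactors T d) :
    HasGradientAt (fun w : EuclideanSpace ℝ V => curvatureEnergy T d w.ofLp)
      (WithLp.toLp 2 (curvatureMap T d u)) (logCoord u) := by
  have he := expLength_log d hu.1
  have h := (hasStrictFDerivAt_curvatureEnergy (T := T) (d := d) (w := fun i => Real.log (u i))
    (he.symm ▸ hu.2)).hasFDerivAt
  rw [he] at h
  rw [hasGradientAt_iff_hasFDerivAt]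
  refine (HasFDerivAt.comp (logCoord u) h
    (EuclideanSpace.equiv V ℝ).toContinuousLinearMap.hasFDerivAt).congr_fderiv ?_
  ext x
  simp [curvatureMap, PiLp.inner_apply, mul_comm]

theorem isYamabeFlow_iff_isNegGradientFlow {J : Set ℝ} {u : ℝ → V → ℝ} (hJ : J.OrdConnected)
    (h0 : 0 ∈ J) (hu : ∀ t ∈ J, u t ∈ conformalFactors T d) :
    IsYamabeFlow T d J u ↔ logCoord (u 0) = 0 ∧
      IsNegGradientFlow (fun w : EuclideanSpace ℝ V => curvatureEnergy T d w.ofLp) J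
        fun t => logCoord (u t) := by
  have hinit : logCoord (u 0) = 0 ↔ ∀ i, u 0 i = 1 := by
    rw [PiLp.ext_iff]
    refine forall_congr' fun i => ?_
    have hpos := (hu 0 h0).1 i
    constructor
    · intro h
      exact Real.eq_one_of_pos_of_log_eq_zero hpos h
    · intro h
      simp [logCoord, h]
  have hflow : ∀ t ∈ J, (HasDerivWithinAt (fun t => logCoord (u t))
      (-∇ (fun w : EuclideanSpace ℝ V => curvatureEnergy T d w.ofLp) (logCoord (u t))) J t ↔
      ∀ i, HasDerivWithinAt (fun s => u s i) (-(u t i) * curvatureMap T d (u t) i) J t) := by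
    intro t ht
    rw [(hasGradientAt_curvatureEnergy (hu t ht)).gradient, hasDerivWithinAt_euclideanSpace]
    refine forall_congr' fun i => ?_
    have hpos := (hu t ht).1 i
    constructor
    · intro h
      refine (h.exp.congr (fun s hs => ?_) ?_).congr_deriv ?_
      · exact (Real.exp_log ((hu s hs).1 i)).symm
      · exact (Real.exp_log hpos).symm
      · simp [logCoord, Real.exp_log hpos]
    · intro h
      refine (h.log hpos.ne').congr_deriv ?_
      simp
      field_simp
  rw [hinit]
  exact ⟨fun h => ⟨h.init, fun t ht => (hflow t ht).2 (h.deriv t ht)⟩,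
    fun h => ⟨hJ, h0, hu, fun t ht => (hflow t ht).1 (h.2 t ht), h.1⟩⟩

end Energy

/-! ### Local rigidity by the inverse function theorem. -/

section Rigidity

variable {V : Type*} [Fintype V] [DecidableEq V] {T : AbstractSimplicialComplex V}
  {d : Finset V → ℝ}

/-- The curvature, made transversal to the hyperplane of Gauss-Bonnet by adding the sum of the
`log u_i` to each component. -/
noncomputable def extendedCurvature (T : AbstractSimplicialComplex V) (d : Finset V → ℝ)
    (u : V → ℝ) : V → ℝ :=
  fun i => curvatureMap T d u i + ∑ j, Real.log (u j)

/-- By Gauss-Bonnet the components sum to `2πχ + N ∑ log u_j`, and `N ≠ 0` because a connected graph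
is nonempty. -/
theorem extendedCurvature_mem_gaussBonnetPlane_iff (hT : IsClosedSurface T) {u : V → ℝ}
    (hu : u ∈ conformalFactors T d) :
    extendedCurvature T d u ∈ gaussBonnetPlane T ↔ ∏ j, u j = 1 := by
  have := hT.connected.nonempty
  have hN : (Fintype.card V : ℝ) ≠ 0 := Nat.cast_ne_zero.2 Fintype.card_ne_zero
  have hs : ∑ i, curvatureMap T d u i = 2 * Real.pi * (eulerChar T : ℝ) := hT.sum_curvature hu.2
  rw [← sum_log_eq_zero_iff hu.1, gaussBonnetPlane, Set.mem_ofPred_eq]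
  simp only [extendedCurvature]
  rw [Finset.sum_add_distrib, hs, Finset.sum_const, Finset.card_univ, nsmul_eq_mul]
  simp [hN]

theorem exists_hasStrictFDerivAt_extendedCurvature (hT : IsClosedSurface T) {u : V → ℝ}
    (hu : u ∈ conformalFactors T d) :
    ∃ L : (V → ℝ) ≃L[ℝ] (V → ℝ),
      HasStrictFDerivAt (extendedCurvature T d) (L : (V → ℝ) →L[ℝ] (V → ℝ)) u := by
  set D : (V → ℝ) →L[ℝ] (V → ℝ) := ContinuousLinearMap.pi fun i =>
    (u i)⁻¹ • ContinuousLinearMap.proj (R := ℝ) (φ := fun _ : V => ℝ) i with hD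
  set M : (V → ℝ) →L[ℝ] (V → ℝ) := curvatureDeriv T (conformalChange u d) ∘L D +
    ContinuousLinearMap.pi fun _ =>
      ∑ j, (u j)⁻¹ • ContinuousLinearMap.proj (R := ℝ) (φ := fun _ : V => ℝ) j with hM
  have hder : HasStrictFDerivAt (extendedCurvature T d) M u := by
    refine (hasStrictFDerivAt_curvatureMap hu).add (hasStrictFDerivAt_pi.2 fun _ => ?_)
    exact HasStrictFDerivAt.fun_sum fun j _ => hasStrictFDerivAt_pi.1 (hasStrictFDerivAt_log hu.1) j
  have hinj : Function.Injective M := by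
    refine (injective_iff_map_eq_zero M).2 fun x hx => ?_
    set y := D x with hy
    have hyi : ∀ i, y i = (u i)⁻¹ * x i := fun i => by simp [hy, hD]
    have hMx : ∀ i, M x i = curvatureDeriv T (conformalChange u d) y i + ∑ j, y j := fun i => by
      simp [hM, hyi, ← hy]
    -- Pairing `M x = 0` with `y` gives two nonnegative terms: the first makes `y` constant, the
    -- second makes its sum zero.
    have hq : ∑ i, y i * curvatureDeriv T (conformalChange u d) y i + (∑ j, y j) ^ 2 = 0 := by
      have : ∑ i, y i * M x i = 0 := by simp [hx]
      simp only [hMx, mul_add] at this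
      rwa [Finset.sum_add_distrib, ← Finset.sum_mul, ← sq] at this
    have hnn := hu.2.sum_mul_curvatureDeriv_nonneg y
    have h1 : ∑ i, y i * curvatureDeriv T (conformalChange u d) y i = 0 := by
      nlinarith [sq_nonneg (∑ j, y j)]
    have h2 : ∑ j, y j = 0 := by
      rw [h1, zero_add] at hq
      exact pow_eq_zero_iff two_ne_zero |>.1 hq
    ext i
    have hc := hu.2.eq_of_sum_mul_curvatureDeriv_eq_zero hT h1
    rw [Finset.sum_congr rfl fun j _ => hc j i, Finset.sum_const, Finset.card_univ, nsmul_eq_mul]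
      at h2
    have : Nonempty V := ⟨i⟩
    have hyi0 : y i = 0 := by simpa [Fintype.card_ne_zero] using h2
    rw [hyi] at hyi0
    simpa [(hu.1 i).ne'] using hyi0
  refine ⟨(LinearEquiv.ofInjectiveEndo (M : (V → ℝ) →ₗ[ℝ] (V → ℝ)) hinj).toContinuousLinearEquiv,
    hder.congr_fderiv ?_⟩
  ext x i
  simp

theorem mapsTo_curvatureMap (hT : IsClosedSurface T) (d : Finset V → ℝ) :
    Set.MapsTo (curvatureMap T d) (normalizedConformalFactors T d) (gaussBonnetPlane T) :=
  fun _ hu => hT.sum_curvature hu.1.2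

theorem isLocalHomeomorph_curvatureMap (hT : IsClosedSurface T) (d : Finset V → ℝ) :
    IsLocalHomeomorph (mapsTo_curvatureMap hT d).restrict := by
  refine isLocalHomeomorph_of_openPartialHomeomorph fun u => ?_
  obtain ⟨L, hL⟩ := exists_hasStrictFDerivAt_extendedCurvature hT u.2.1
  have ho := isOpen_conformalFactors T d
  -- The source is cut down to the conformal factors, where meeting the hyperplane is equivalent to
  -- `∏ u_j = 1`.
  refine ⟨(hL.toOpenPartialHomeomorph _).restrOpen _ ho,
    ⟨hL.mem_toOpenPartialHomeomorph_source, u.2.1⟩, fun y _ => ?_, fun z hz hB => ?_⟩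
  · have : ∑ j, Real.log (y.1 j) = 0 := (sum_log_eq_zero_iff y.2.1.1).2 y.2.2
    funext i
    change curvatureMap T d y.1 i + ∑ j, Real.log (y.1 j) = curvatureMap T d y.1 i
    rw [this, add_zero]
  · exact ⟨hz.2, (extendedCurvature_mem_gaussBonnetPlane_iff hT hz.2).1 hB⟩

end Rigidity

end CombYamabe

theorem theorem1p2 {V : Type*} [DecidableEq V] [Fintype V]
    (T : AbstractSimplicialComplex V) (hT : CombYamabe.IsClosedSurface T)
    (d : Finset V → ℝ) (hd : CombYamabe.IsPLMetric T d) :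
    -- (a) the heat equation for the curvature, and the decay of the total curvature
    ((∃ c : (V → ℝ) → Matrix V V ℝ,
        (∀ u ∈ CombYamabe.conformalFactors T d,
          (c u).IsSymm ∧ (-(c u)).PosSemidef ∧
          ∀ i j, HasDerivAt (fun s => CombYamabe.curvatureMap T d (Function.update u j s) i)
            (-(c u i j) / u j) (u j)) ∧
        ∀ (J : Set ℝ) (u : ℝ → V → ℝ), CombYamabe.IsYamabeFlow T d J u → ∀ t ∈ J, ∀ i,
          HasDerivWithinAt (fun s => CombYamabe.curvatureMap T d (u s) i)
            (∑ j, c (u t) i j * CombYamabe.curvatureMap T d (u t) j) J t) ∧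
      ∀ (J : Set ℝ) (u : ℝ → V → ℝ), CombYamabe.IsYamabeFlow T d J u →
        AntitoneOn (fun t => ∑ i, CombYamabe.curvatureMap T d (u t) i ^ 2) J) ∧
    -- (b) the flow is the negative gradient flow of a locally convex function of `w = log u`
    (∃ F : EuclideanSpace ℝ V → ℝ,
      CombYamabe.LocallyConvexOn (CombYamabe.logConformalFactors T d) F ∧
      (∀ u ∈ CombYamabe.conformalFactors T d,
        HasGradientAt F (WithLp.toLp 2 (CombYamabe.curvatureMap T d u)) (CombYamabe.logCoord u)) ∧
      ∀ (J : Set ℝ) (u : ℝ → V → ℝ), J.OrdConnected → 0 ∈ J →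
        (∀ t ∈ J, u t ∈ CombYamabe.conformalFactors T d) →
        (CombYamabe.IsYamabeFlow T d J u ↔
          CombYamabe.logCoord (u 0) = 0 ∧
            CombYamabe.IsNegGradientFlow F J fun t => CombYamabe.logCoord (u t))) ∧
    -- (c) local rigidity
    ∃ h : Set.MapsTo (CombYamabe.curvatureMap T d)
        (CombYamabe.normalizedConformalFactors T d) (CombYamabe.gaussBonnetPlane T),
      IsLocalHomeomorph h.restrict := by
  open CombYamabe in
  exact ⟨⟨⟨fun u => heatMatrix T (conformalChange u d), fun u hu => ⟨isSymm_heatMatrix _,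
      hu.2.posSemidef_neg_heatMatrix, hasDerivAt_curvatureMap_update hu⟩,
      fun _ _ hu _ ht i => hu.hasDerivWithinAt_curvatureMap ht i⟩,
      fun _ _ hu => hu.antitoneOn_sum_sq⟩,
    ⟨_, locallyConvexOn_curvatureEnergy T d, fun _ hu => hasGradientAt_curvatureEnergy hu,
      fun _ _ hJ h0 hu => isYamabeFlow_iff_isNegGradientFlow hJ h0 hu⟩,
    mapsTo_curvatureMap hT d, isLocalHomeomorph_curvatureMap hT d⟩
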